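/- Let $\mathbb{K}$ be a field and $[n]=\{1,\dots,n\}$. Let $\Delta$ be a simplicial complex on $[n]$, that is, a family of subsets of $[n]$ (the faces) that is closed under taking subsets, and assume that $\Delta\neq\emptyset$, so that $\emptyset\in\Delta$; it is not required that every $\{v\}$, $v\in[n]$, is a face. Let $S=\mathbb{K}[x_1,\dots,x_n]$, let $I_\Delta=\langle \prod_{i\in F}x_i : F\subseteq[n],\ F\notin\Delta\rangle$ be the Stanley–Reisner ideal of $\Delta$, and let $T^1(\Delta)$ be the cokernel of the natural map $\operatorname{Der}_{\mathbb{K}}(S,S)\to\operatorname{Hom}_S(I_\Delta,S/I_\Delta)$, with its $\mathbb{Z}^n$-grading. For $b\subseteq[n]$ let $T^1_{-b}(\Delta)$ be the component in degree $-\sum_{i\in b}e_i$, let $\Delta\setminus b=\{F\in\Delta : F\cap b=\emptyset\}$, a complex on $[n]\setminus b$, and let $\partial b=\{A : A\subsetneq b\}$, a complex on $b$. The join of complexes on disjoint ground sets is $\Gamma*\Gamma'=\{F\sqcup G : F\in\Gamma,\ G\in\Gamma'\}$. If $b\subseteq[n]$ is a nonface of $\Delta$, that is, $b\notin\Delta$,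 then $$\dim_{\mathbb{K}} T^1_{-b}(\Delta)=\begin{cases}1 & \text{if } |b|>1 \text{ and } \Delta\cong(\Delta\setminus b)*\partial b,\\ 0 & \text{otherwise.}\end{cases}$$ -/

import Mathlib

/-!  Simplicial complexes, Stanley-Reisner rings and their first cotangent cohomology.  -/

/-- A simplicial complex on the ground set `E`: a family of subsets of `E` that is closed under
taking subsets.  Elements of `E` need not be vertices (`{v}` need not be a face), the complex
`{∅}` is allowed, and so is the void complex that has no face at all. -/
abbrev SimplicialCplx (E : Type*) : Type _ := LowerSet (Finset E)

namespace SimplicialCplx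

/-- The deletion `Δ ∖ W`: the complex on the ground set `E ∖ W` whose faces are the faces of `Δ`
that are contained in `E ∖ W`. -/
def deletion {E : Type*} (Δ : SimplicialCplx E) (W : Finset E) :
    SimplicialCplx {i : E // i ∉ W} where
  carrier := {F | F.map (Function.Embedding.subtype _) ∈ Δ}
  lower' _ _ hle hF := Δ.lower (Finset.map_subset_map.2 hle) hF

/-- The boundary `∂b` of the simplex on `b`: the complex on the ground set `b` whose faces are the
proper subsets of `b`. -/
def boundary {E : Type*} (b : Finset E) : SimplicialCplx {i : E // i ∈ b} where
  carrier := {F | F.map (Function.Embedding.subtype _) ⊂ b}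
  lower' _ _ hle hF := (Finset.map_subset_map.2 hle).trans_ssubset hF

/-- The join `Δ * Γ`, on the disjoint union of the ground sets: its faces are the disjoint unions
of a face of `Δ` and a face of `Γ`. -/
def join {E E' : Type*} (Δ : SimplicialCplx E) (Γ : SimplicialCplx E') :
    SimplicialCplx (E ⊕ E') where
  carrier := {H | ∃ F ∈ Δ, ∃ G ∈ Γ, H = F.disjSum G}
  lower' := by
    rintro _ H hle ⟨F, hF, G, hG, rfl⟩
    refine ⟨H.toLeft, Δ.lower ?_ hF, H.toRight, Γ.lower ?_ hG, H.toLeft_disjSum_toRight.symm⟩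
    · intro x hx
      exact Finset.inl_mem_disjSum.1 (hle (Finset.mem_toLeft.1 hx))
    · intro x hx
      exact Finset.inr_mem_disjSum.1 (hle (Finset.mem_toRight.1 hx))

/-- Isomorphism of simplicial complexes: a bijection of the ground sets under which faces and
faces correspond. -/
def Isomorphic {E E' : Type*} (Δ : SimplicialCplx E) (Γ : SimplicialCplx E') : Prop :=
  ∃ e : E ≃ E', ∀ F : Finset E, F ∈ Δ ↔ F.map e.toEmbedding ∈ Γ

end SimplicialCplx

section CotangentCohomology

open MvPolynomial

/-- The Stanley-Reisner ideal `I_Δ` in `K[x_i : i ∈ E]`, generated by the squarefree monomials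
`∏_{i ∈ F} x_i` for the nonfaces `F` of `Δ`. -/
noncomputable def stanleyReisnerIdeal (K : Type*) [Field K] {E : Type*} (Δ : SimplicialCplx E) :
    Ideal (MvPolynomial E K) :=
  Ideal.span {f | ∃ F : Finset E, F ∉ Δ ∧ f = ∏ i ∈ F, X i}

variable {K E : Type*} [Field K]

/-- The `S`-linear map `I → S/I`, `f ↦ D f mod I`, given by a derivation `D` of
`S = K[x_i : i ∈ E]`. -/
noncomputable def derivationHom (I : Ideal (MvPolynomial E K))
    (D : Derivation K (MvPolynomial E K) (MvPolynomial E K)) :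
    I →ₗ[MvPolynomial E K] (MvPolynomial E K ⧸ I) where
  toFun f := Ideal.Quotient.mk I (D f)
  map_add' f g := by simp
  map_smul' g f := by
    have h : Ideal.Quotient.mk I ((f : MvPolynomial E K) * D g) = 0 :=
      Ideal.Quotient.eq_zero_iff_mem.2 (I.mul_mem_right _ f.2)
    simp only [Submodule.coe_smul, smul_eq_mul, Derivation.leibniz, map_add, h, add_zero,
      RingHom.id_apply]
    rfl

/-- The natural map `Der_K(S, S) → Hom_S(I, S/I)`. -/
noncomputable def derivationMap (I : Ideal (MvPolynomial E K)) :
    Derivation K (MvPolynomial E K) (MvPolynomial E K) →ₗ[MvPolynomial E K]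
      (I →ₗ[MvPolynomial E K] (MvPolynomial E K ⧸ I)) where
  toFun := derivationHom I
  map_add' D D' := by
    ext f
    simp [derivationHom]
  map_smul' g D := by
    ext f
    rfl

/-- The first cotangent cohomology module `T¹(S/I)`: the cokernel of
`Der_K(S, S) → Hom_S(I, S/I)`. -/
abbrev T1 (I : Ideal (MvPolynomial E K)) : Type _ :=
  (I →ₗ[MvPolynomial E K] (MvPolynomial E K ⧸ I)) ⧸ LinearMap.range (derivationMap I)

/-- The component `S_c` of degree `c : E → ℤ` of `S = K[x_i : i ∈ E]`: the polynomials all of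
whose monomials have exponent vector `c`. -/
def polyComponent (K : Type*) [Field K] {E : Type*} (c : E → ℤ) :
    Submodule K (MvPolynomial E K) where
  carrier := {f | ∀ d ∈ f.support, ∀ i, (d i : ℤ) = c i}
  zero_mem' := by simp
  add_mem' {f g} hf hg d hd := by
    classical
    rcases Finset.mem_union.1 (MvPolynomial.support_add hd) with h | h
    · exact hf d h
    · exact hg d h
  smul_mem' a f hf d hd := hf d (MvPolynomial.support_smul hd)

/-- The component `(S/I)_c`: the image of `S_c`. -/
noncomputable def quotientComponent (I : Ideal (MvPolynomial E K)) (c : E → ℤ) :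
    Submodule K (MvPolynomial E K ⧸ I) :=
  (polyComponent K c).map (Ideal.Quotient.mkₐ K I).toLinearMap

/-- The component `Hom_S(I, S/I)_c`: the homomorphisms that map the elements of `I` of degree `d`
to elements of `S/I` of degree `d + c`, for all `d`. -/
noncomputable def homComponent (I : Ideal (MvPolynomial E K)) (c : E → ℤ) :
    Submodule K (I →ₗ[MvPolynomial E K] (MvPolynomial E K ⧸ I)) where
  carrier := {φ | ∀ (d : E → ℤ) (f : I), (f : MvPolynomial E K) ∈ polyComponent K d →
    φ f ∈ quotientComponent I (d + c)}
  zero_mem' _ _ _ := Submodule.zero_mem _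
  add_mem' hφ hψ d f hf := Submodule.add_mem _ (hφ d f hf) (hψ d f hf)
  smul_mem' a _ hφ d f hf := Submodule.smul_mem _ a (hφ d f hf)

/-- The component `T¹_c(S/I)` of degree `c` of the first cotangent cohomology, for the grading
that `T¹(S/I)` has as a quotient of `Hom_S(I, S/I)` (meaningful for monomial ideals `I`). -/
noncomputable def T1Component (I : Ideal (MvPolynomial E K)) (c : E → ℤ) : Submodule K (T1 I) :=
  (homComponent I c).map ((LinearMap.range (derivationMap I)).mkQ.restrictScalars K)

/-- The degree `-b`, for a subset `b` of `E` identified with its indicator vector in `{0,1}^E`. -/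
noncomputable def negIndicator (b : Finset E) : E → ℤ :=
  -((b : Set E).indicator 1)

end CotangentCohomology

/-! Write `x_F` for the product of the variables in `F`. By degree, a homomorphism `φ` of degree
`-b` kills every generator `x_F` with `b ⊄ F` and sends `x_b` to a constant `c`. The other
generators are multiples of `x_b`, so `c` determines `φ`. The syzygy between `x_b` and `x_F` gives
`c * x_{F ∖ b} ∈ I_Δ` for each nonface `F` with `b ⊄ F`. So `c ≠ 0` forces `Δ` to be the join
(`mem_of_apply_prod_X_ne_zero`). For the join, division by `x_b` is a homomorphism
(`divMonomialHom`) spanning the component. It remains to compare with derivations: if `|b| > 1`,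
they send `x_b` into the polynomials without constant term, hence never to `1` modulo `I_Δ`; if `b =
{v}`, then `φ` is induced by `c ∂/∂x_v`. -/

section StanleyReisner

open MvPolynomial

variable {K E : Type*} [Field K]

/-! ### Faces of the join `(Δ ∖ b) * ∂b`. -/

namespace SimplicialCplx

/-- The decomposition of the ground set as the disjoint union of `E ∖ b` and `b`. -/
def sumGround [DecidableEq E] (b : Finset E) : {i // i ∉ b} ⊕ {i // i ∈ b} ≃ E :=
  (Equiv.sumComm _ _).trans (Equiv.sumCompl (· ∈ b))

theorem map_sumGround_symm_mem_join_iff [DecidableEq E] {Δ : SimplicialCplx E} {b F : Finset E} :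
    F.map (sumGround b).symm.toEmbedding ∈ join (deletion Δ b) (boundary b) ↔
      F \ b ∈ Δ ∧ ¬ b ⊆ F := by
  set H := F.map (sumGround b).symm.toEmbedding with hH
  have hmem : ∀ x, x ∈ H ↔ sumGround b x ∈ F := fun x ↦ by
    rw [hH, Finset.mem_map_equiv, Equiv.symm_symm]
  have hl : H.toLeft.map (Function.Embedding.subtype _) = F \ b := by
    ext i
    simp [hmem, sumGround, and_comm]
  have hr : H.toRight.map (Function.Embedding.subtype _) = F ∩ b := by
    ext i
    simp [hmem, sumGround, and_comm]
  have hmemJoin : H ∈ join (deletion Δ b) (boundary b) ↔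
      H.toLeft ∈ deletion Δ b ∧ H.toRight ∈ boundary b := by
    constructor
    · rintro ⟨A, hA, B, hB, h⟩
      rw [h, Finset.toLeft_disjSum, Finset.toRight_disjSum]
      exact ⟨hA, hB⟩
    · rintro ⟨hA, hB⟩
      exact ⟨_, hA, _, hB, H.toLeft_disjSum_toRight.symm⟩
  rw [hmemJoin]
  refine and_congr ?_ ?_
  · change H.toLeft.map (Function.Embedding.subtype _) ∈ Δ ↔ _
    rw [hl]
  · change H.toRight.map (Function.Embedding.subtype _) ⊂ b ↔ _
    rw [hr, Finset.ssubset_iff_subset_ne, and_iff_right Finset.inter_subset_right, ne_eq,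
      Finset.inter_eq_right]

/-- If `b` is a nonface and `Δ` is abstractly isomorphic to `(Δ ∖ b) * ∂b`, then `Δ` is this
join: a set `F` with `F ∖ b ∈ Δ` and `b ⊄ F` is a face. -/
theorem mem_of_isomorphic_join [Finite E] [DecidableEq E] {Δ : SimplicialCplx E} {b : Finset E}
    (hb : b ∉ Δ) (h : Isomorphic Δ (join (deletion Δ b) (boundary b))) {F : Finset E}
    (hF : F \ b ∈ Δ) (hbF : ¬ b ⊆ F) : F ∈ Δ := by
  obtain ⟨e, he⟩ := h
  let σ : E ≃ E := e.trans (sumGround b)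
  let Γ : Set (Finset E) := {F | F \ b ∈ Δ ∧ ¬ b ⊆ F}
  have hσ : ∀ F : Finset E, F ∈ Δ ↔ F.map σ.toEmbedding ∈ Γ := fun F ↦ by
    rw [he, Set.mem_ofPred_eq, ← map_sumGround_symm_mem_join_iff, Finset.map_map]
    congr!
    ext x
    simp [σ]
  -- Since `b` is a nonface, `Δ` always lies in the join `Γ`. An abstract isomorphism makes these
  -- finite families equinumerous, hence equal.
  have hsub : (Δ : Set (Finset E)) ⊆ Γ := fun G hG ↦
    ⟨Δ.lower Finset.sdiff_subset hG, fun hbG ↦ hb (Δ.lower hbG hG)⟩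
  have himage : Γ ⊆ Finset.map σ.toEmbedding '' (Δ : Set (Finset E)) := fun G hG ↦ by
    have hG' : (G.map σ.symm.toEmbedding).map σ.toEmbedding = G := by
      ext x
      simp [Finset.mem_map_equiv]
    exact ⟨G.map σ.symm.toEmbedding, (hσ _).2 (hG'.symm ▸ hG), hG'⟩
  have hcard : Γ.ncard ≤ (Δ : Set (Finset E)).ncard :=
    (Set.ncard_le_ncard himage (Set.toFinite _)).trans (Set.ncard_image_le (Set.toFinite _))
  have hEq := Set.eq_of_subset_of_ncard_le hsub hcard (Set.toFinite _)
  have : F ∈ Γ := ⟨hF, hbF⟩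
  rwa [← hEq] at this

theorem isomorphic_join [DecidableEq E] {Δ : SimplicialCplx E} {b : Finset E}
    (hb : b ∉ Δ) (h : ∀ F : Finset E, F \ b ∈ Δ → ¬ b ⊆ F → F ∈ Δ) :
    Isomorphic Δ (join (deletion Δ b) (boundary b)) := by
  refine ⟨(sumGround b).symm, fun F ↦ ?_⟩
  rw [map_sumGround_symm_mem_join_iff]
  exact ⟨fun hF ↦ ⟨Δ.lower Finset.sdiff_subset hF, fun hbF ↦ hb (Δ.lower hbF hF)⟩,
    fun hF ↦ h F hF.1 hF.2⟩

end SimplicialCplx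

/-! ### Elements and generators of the Stanley-Reisner ideal. -/

theorem prod_X_mem_stanleyReisnerIdeal {Δ : SimplicialCplx E} {F : Finset E} (hF : F ∉ Δ) :
    ∏ i ∈ F, X i ∈ stanleyReisnerIdeal K Δ :=
  Ideal.subset_span ⟨F, hF, rfl⟩

theorem monomial_mem_stanleyReisnerIdeal {Δ : SimplicialCplx E} {p : E →₀ ℕ} {F : Finset E}
    (hF : F ∉ Δ) (hp : ∀ i ∈ F, p i ≠ 0) (c : K) : monomial p c ∈ stanleyReisnerIdeal K Δ := by
  classical
  have hs : p.support ∉ Δ := fun h ↦ hF (Δ.lower (fun i hi ↦ by simpa using hp i hi) h)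
  rw [monomial_eq]
  refine Ideal.mul_mem_left _ _ (Ideal.mem_of_dvd _ ?_ (prod_X_mem_stanleyReisnerIdeal hs))
  exact Finset.prod_dvd_prod_of_dvd _ _ fun i hi ↦ dvd_pow_self _ (Finsupp.mem_support_iff.1 hi)

/-- The polynomials in `I_Δ` vanish at the indicator vectors of the faces of `Δ`. -/
theorem eval_indicator_eq_zero_of_mem_stanleyReisnerIdeal {Δ : SimplicialCplx E} {G : Finset E}
    (hG : G ∈ Δ) {f : MvPolynomial E K} (hf : f ∈ stanleyReisnerIdeal K Δ) :
    eval ((G : Set E).indicator 1) f = 0 := by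
  have : stanleyReisnerIdeal K Δ ≤ RingHom.ker (eval ((G : Set E).indicator (1 : E → K))) := by
    refine Ideal.span_le.2 ?_
    rintro _ ⟨F, hF, rfl⟩
    obtain ⟨i, hiF, hiG⟩ := Finset.not_subset.1 fun h ↦ hF (Δ.lower h hG)
    simp only [SetLike.mem_coe, RingHom.mem_ker, map_prod, eval_X]
    exact Finset.prod_eq_zero hiF (Set.indicator_of_notMem (by simpa using hiG) _)
  exact this hf

/-- The empty set is a face, and its indicator vector is the origin. -/
theorem constantCoeff_eq_zero_of_mem_stanleyReisnerIdeal {Δ : SimplicialCplx E}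
    (hΔ : (Δ : Set (Finset E)).Nonempty) {f : MvPolynomial E K}
    (hf : f ∈ stanleyReisnerIdeal K Δ) : constantCoeff f = 0 := by
  obtain ⟨G, hG⟩ := hΔ
  have h := eval_indicator_eq_zero_of_mem_stanleyReisnerIdeal
    (Δ.lower (Finset.empty_subset G) hG) hf
  rw [Finset.coe_empty, Set.indicator_empty] at h
  rw [← h, constantCoeff_eq]
  exact (DFunLike.congr_fun eval_zero f).symm

/-- A homomorphism on `I_Δ` vanishes if it vanishes on `x_b` and on all generators `x_F` with
`b ⊄ F`. -/
theorem stanleyReisnerIdeal_hom_eq_zero {M : Type*} [AddCommGroup M] [Module (MvPolynomial E K) M]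
    {Δ : SimplicialCplx E} {b : Finset E} (hb : b ∉ Δ)
    (φ : stanleyReisnerIdeal K Δ →ₗ[MvPolynomial E K] M)
    (h0 : φ ⟨_, prod_X_mem_stanleyReisnerIdeal hb⟩ = 0)
    (h1 : ∀ (F : Finset E) (hF : F ∉ Δ), ¬ b ⊆ F →
      φ ⟨_, prod_X_mem_stanleyReisnerIdeal hF⟩ = 0) : φ = 0 := by
  classical
  ext ⟨f, hf⟩
  change φ ⟨f, hf⟩ = 0
  have hf' := hf
  unfold stanleyReisnerIdeal at hf'
  induction hf' using Submodule.span_induction with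
  | mem x hx =>
    obtain ⟨F, hF, rfl⟩ := hx
    by_cases hbF : b ⊆ F
    · have : (⟨_, hf⟩ : stanleyReisnerIdeal K Δ) =
          (∏ i ∈ F \ b, X i : MvPolynomial E K) • ⟨_, prod_X_mem_stanleyReisnerIdeal hb⟩ :=
        Subtype.ext (Finset.prod_sdiff hbF).symm
      rw [this, map_smul, h0, smul_zero]
    · exact h1 F hF hbF
  | zero => exact map_zero φ
  | add x y hx hy ihx ihy =>
    have hx' : x ∈ stanleyReisnerIdeal K Δ := hx
    have hy' : y ∈ stanleyReisnerIdeal K Δ := hy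
    have h := map_add φ ⟨x, hx'⟩ ⟨y, hy'⟩
    rw [ihx, ihy, add_zero] at h
    exact h
  | smul a x hx ih =>
    have hx' : x ∈ stanleyReisnerIdeal K Δ := hx
    have h := map_smul φ a ⟨x, hx'⟩
    rw [ih, smul_zero] at h
    exact h

theorem prod_X_eq_monomial (F : Finset E) :
    (∏ i ∈ F, X i : MvPolynomial E K) = monomial (Finsupp.indicator F fun _ _ ↦ 1) 1 := by
  classical
  rw [monomial_eq, C_1, one_mul, Finsupp.prod_of_support_subset _
    (Finsupp.support_indicator_subset F _) _ (by simp)]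
  exact Finset.prod_congr rfl fun i hi ↦ by simp [Finsupp.indicator_of_mem hi]

/-! ### Homomorphisms of degree `-b` on the generators. -/

theorem prod_X_mem_polyComponent (F : Finset E) :
    (∏ i ∈ F, X i : MvPolynomial E K) ∈ polyComponent K ((F : Set E).indicator 1) := by
  classical
  intro d hd i
  rw [prod_X_eq_monomial] at hd
  obtain rfl := Finset.mem_singleton.1 (support_monomial_subset hd)
  by_cases hi : i ∈ F <;> simp [Finsupp.indicator_apply, hi]

/-- The image would have exponent `-1` at any `i ∈ b ∖ F`. -/
theorem apply_prod_X_eq_zero_of_mem_homComponent {Δ : SimplicialCplx E} {b F : Finset E}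
    {φ : stanleyReisnerIdeal K Δ →ₗ[MvPolynomial E K] (MvPolynomial E K ⧸ stanleyReisnerIdeal K Δ)}
    (hφ : φ ∈ homComponent _ (negIndicator b)) (hF : F ∉ Δ) (hbF : ¬ b ⊆ F) :
    φ ⟨_, prod_X_mem_stanleyReisnerIdeal hF⟩ = 0 := by
  classical
  obtain ⟨g, hg, hφg⟩ := hφ _ ⟨_, prod_X_mem_stanleyReisnerIdeal hF⟩ (prod_X_mem_polyComponent F)
  obtain ⟨i, hib, hiF⟩ := Finset.not_subset.1 hbF
  have : g = 0 := by
    rw [← support_eq_empty, Finset.eq_empty_iff_forall_notMem]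
    intro d hd
    have := hg d hd i
    simp [negIndicator, hib, hiF] at this
  rw [← hφg, this, map_zero]

theorem exists_apply_prod_X_eq_of_mem_homComponent {Δ : SimplicialCplx E} {b : Finset E}
    (hb : b ∉ Δ)
    {φ : stanleyReisnerIdeal K Δ →ₗ[MvPolynomial E K] (MvPolynomial E K ⧸ stanleyReisnerIdeal K Δ)}
    (hφ : φ ∈ homComponent _ (negIndicator b)) :
    ∃ c : K, φ ⟨_, prod_X_mem_stanleyReisnerIdeal hb⟩ = Ideal.Quotient.mk _ (C c) := by
  classical
  obtain ⟨g, hg, hφg⟩ := hφ _ ⟨_, prod_X_mem_stanleyReisnerIdeal hb⟩ (prod_X_mem_polyComponent b)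
  refine ⟨constantCoeff g, hφg.symm.trans (congrArg _ ?_)⟩
  ext d
  by_cases hd : d = 0
  · subst hd
    simp [constantCoeff_eq]
  · rw [coeff_C, if_neg (Ne.symm hd)]
    by_contra hne
    refine hd (Finsupp.ext fun i ↦ ?_)
    have := hg d (mem_support_iff.2 hne) i
    simpa [negIndicator] using this

/-- If `φ ∈ Hom(I_Δ, S/I_Δ)` has degree `-b`, then `φ(x_b) = 0` unless `F ∖ b ∈ Δ` and `b ⊄ F`
imply `F ∈ Δ`. -/
theorem mem_of_apply_prod_X_ne_zero [DecidableEq E] {Δ : SimplicialCplx E} {b : Finset E}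
    (hb : b ∉ Δ)
    {φ : stanleyReisnerIdeal K Δ →ₗ[MvPolynomial E K] (MvPolynomial E K ⧸ stanleyReisnerIdeal K Δ)}
    (hφ : φ ∈ homComponent _ (negIndicator b))
    (h : φ ⟨_, prod_X_mem_stanleyReisnerIdeal hb⟩ ≠ 0) {F : Finset E}
    (hF : F \ b ∈ Δ) (hbF : ¬ b ⊆ F) : F ∈ Δ := by
  by_contra hFΔ
  obtain ⟨c, hc⟩ := exists_apply_prod_X_eq_of_mem_homComponent hb hφ
  -- Both sides are `x_{b ∪ F}`.
  have hrel : (∏ i ∈ F \ b, X i : MvPolynomial E K) •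
      (⟨_, prod_X_mem_stanleyReisnerIdeal hb⟩ : stanleyReisnerIdeal K Δ) =
      (∏ i ∈ b \ F, X i : MvPolynomial E K) • ⟨_, prod_X_mem_stanleyReisnerIdeal hFΔ⟩ := by
    refine Subtype.ext ?_
    change (∏ i ∈ F \ b, X i) * (∏ i ∈ b, X i) = (∏ i ∈ b \ F, X i) * (∏ i ∈ F, X i)
    rw [← Finset.prod_union Finset.sdiff_disjoint, ← Finset.prod_union Finset.sdiff_disjoint,
      Finset.sdiff_union_self_eq_union, Finset.sdiff_union_self_eq_union, Finset.union_comm]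
  have h0 := congrArg φ hrel
  rw [map_smul, map_smul, apply_prod_X_eq_zero_of_mem_homComponent hφ hFΔ hbF, smul_zero, hc] at h0
  have h1 : (∏ i ∈ F \ b, X i) * C c ∈ stanleyReisnerIdeal K Δ :=
    Ideal.Quotient.eq_zero_iff_mem.1 h0
  -- At the indicator vector of the face `F ∖ b` the monomial takes the value `1`, so `c = 0`.
  have h2 := eval_indicator_eq_zero_of_mem_stanleyReisnerIdeal hF h1
  have h3 : ∏ i ∈ F \ b, ((F \ b : Finset E) : Set E).indicator (1 : E → K) i = 1 :=
    Finset.prod_eq_one fun i hi ↦ Set.indicator_of_mem (Finset.mem_coe.2 hi) _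
  rw [map_mul, eval_C, map_prod] at h2
  simp only [eval_X] at h2
  rw [h3, one_mul] at h2
  rw [hc, h2, map_zero, map_zero] at h
  exact h rfl

/-! ### Division by `x_b`. -/

theorem monomial_divMonomial_of_not_le {R σ : Type*} [CommSemiring R] {p s : σ →₀ ℕ}
    (h : ¬ s ≤ p) (c : R) : (monomial p c).divMonomial s = 0 := by
  classical
  ext d
  rw [coeff_divMonomial, coeff_monomial, if_neg, coeff_zero]
  rintro rfl
  exact h le_self_add

section DivMonomial

variable [DecidableEq E] {Δ : SimplicialCplx E} {b : Finset E}

/-- Dropping the non-multiples of `x_b` is not linear on `S`: `x_F` may be dropped while a multiple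
of it survives. The resulting quotient is divisible by `x_{F ∖ b}`, which lies in `I_Δ` by `h`, so
linearity holds modulo `I_Δ`. -/
theorem mk_divMonomial_mul (h : ∀ F : Finset E, F \ b ∈ Δ → ¬ b ⊆ F → F ∈ Δ)
    {f : MvPolynomial E K} (hf : f ∈ stanleyReisnerIdeal K Δ) (g : MvPolynomial E K) :
    Ideal.Quotient.mk (stanleyReisnerIdeal K Δ)
        ((g * f).divMonomial (Finsupp.indicator b fun _ _ ↦ 1)) =
      Ideal.Quotient.mk (stanleyReisnerIdeal K Δ)
        (g * f.divMonomial (Finsupp.indicator b fun _ _ ↦ 1)) := by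
  unfold stanleyReisnerIdeal at hf
  -- The multiplier varies because the case `a • x` uses the induction hypothesis for both `g * a`
  -- and `a`.
  induction hf using Submodule.span_induction generalizing g with
  | mem x hx =>
    obtain ⟨F, hF, rfl⟩ := hx
    by_cases hbF : b ⊆ F
    · rw [← Finset.prod_sdiff hbF, mul_comm, mul_comm (∏ i ∈ F \ b, X i), mul_assoc,
        prod_X_eq_monomial b, divMonomial_monomial_mul, divMonomial_monomial_mul, mul_comm]
    · obtain ⟨j, hjb, hjF⟩ := Finset.not_subset.1 hbF
      rw [prod_X_eq_monomial F, monomial_divMonomial_of_not_le, mul_zero, map_zero]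
      · induction g using MvPolynomial.induction_on' with
        | monomial q c =>
          rw [monomial_mul, mul_one, Ideal.Quotient.eq_zero_iff_mem]
          by_cases hle : (Finsupp.indicator b fun _ _ ↦ 1 : E →₀ ℕ) ≤
              q + Finsupp.indicator F fun _ _ ↦ 1
          · obtain ⟨r, hr⟩ := exists_add_of_le hle
            rw [hr, ← mul_one c, ← one_mul (c * 1), ← monomial_mul, mul_one,
              divMonomial_monomial_mul]
            refine monomial_mem_stanleyReisnerIdeal (F := F \ b) (fun h' ↦ hF (h F h' hbF)) ?_ c
            intro i hi
            have := DFunLike.congr_fun hr i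
            obtain ⟨hiF, hib⟩ := Finset.mem_sdiff.1 hi
            simp [Finsupp.indicator_apply, hiF, hib] at this
            omega
          · rw [monomial_divMonomial_of_not_le hle]
            exact Ideal.zero_mem _
        | add g g' hg hg' => rw [add_mul, add_divMonomial, map_add, hg, hg', add_zero]
      · intro hle
        have := hle j
        simp [Finsupp.indicator_apply, hjb, hjF] at this
  | zero => simp
  | add x y _ _ hx hy => rw [mul_add, add_divMonomial, map_add, hx, hy, ← map_add, ← mul_add,
      add_divMonomial]
  | smul a x _ hx =>
    rw [smul_eq_mul, ← mul_assoc, hx, map_mul _ g, hx, ← map_mul, mul_assoc]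

/-- If `Δ = (Δ ∖ b) * ∂b`, the homomorphism `I_Δ → S/I_Δ`, `f ↦ f / x_b`, where the monomials of
`f` that are not multiples of `x_b` are dropped. -/
noncomputable def divMonomialHom (K : Type*) [Field K]
    (h : ∀ F : Finset E, F \ b ∈ Δ → ¬ b ⊆ F → F ∈ Δ) :
    stanleyReisnerIdeal K Δ →ₗ[MvPolynomial E K] (MvPolynomial E K ⧸ stanleyReisnerIdeal K Δ) where
  toFun f := Ideal.Quotient.mk _ ((f : MvPolynomial E K).divMonomial
    (Finsupp.indicator b fun _ _ ↦ 1))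
  map_add' f g := by simp [add_divMonomial]
  map_smul' g f := mk_divMonomial_mul h f.2 g

theorem divMonomialHom_prod_X (h : ∀ F : Finset E, F \ b ∈ Δ → ¬ b ⊆ F → F ∈ Δ) (hb : b ∉ Δ) :
    divMonomialHom K h ⟨_, prod_X_mem_stanleyReisnerIdeal hb⟩ = 1 := by
  change Ideal.Quotient.mk _ ((∏ i ∈ b, X i : MvPolynomial E K).divMonomial _) = 1
  rw [prod_X_eq_monomial, divMonomial_monomial, map_one]

theorem divMonomialHom_mem_homComponent (h : ∀ F : Finset E, F \ b ∈ Δ → ¬ b ⊆ F → F ∈ Δ) :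
    divMonomialHom K h ∈ homComponent _ (negIndicator b) := by
  intro d f hf
  refine ⟨(f : MvPolynomial E K).divMonomial (Finsupp.indicator b fun _ _ ↦ 1), ?_, rfl⟩
  intro e he i
  rw [mem_support_iff, coeff_divMonomial] at he
  have := hf _ (mem_support_iff.2 he) i
  by_cases hi : i ∈ b <;> simp [negIndicator, Finsupp.indicator_apply, hi] at this ⊢ <;> omega

end DivMonomial

/-! ### Comparison with derivations. -/

/-- A derivation maps a product of at least two variables to a polynomial without constant term. -/
theorem constantCoeff_derivation_prod_X {b : Finset E} (hb : 1 < b.card)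
    (D : Derivation K (MvPolynomial E K) (MvPolynomial E K)) :
    constantCoeff (D (∏ i ∈ b, X i)) = 0 := by
  classical
  obtain ⟨i, hi, j, hj, hij⟩ := Finset.one_lt_card.1 hb
  have hj' : j ∈ b.erase i := Finset.mem_erase.2 ⟨hij.symm, hj⟩
  rw [← Finset.mul_prod_erase b _ hi, Derivation.leibniz, smul_eq_mul, smul_eq_mul, map_add,
    map_mul, map_mul, constantCoeff_X, zero_mul, zero_add,
    map_prod (constantCoeff (σ := E) (R := K)),
    Finset.prod_eq_zero hj' (constantCoeff_X K j), zero_mul]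

theorem pderiv_prod_X_eq_zero {F : Finset E} {v : E} (hv : v ∉ F) :
    pderiv v (∏ i ∈ F, X i : MvPolynomial E K) = 0 := by
  classical
  refine pderiv_eq_zero_of_notMem_vars fun h ↦ hv ?_
  rw [prod_X_eq_monomial, vars_monomial one_ne_zero] at h
  exact Finsupp.support_indicator_subset F _ h

/-- In degree `-e_v`, for a nonvertex `v`, every homomorphism is induced by a multiple of
`∂/∂x_v`. -/
theorem mem_range_derivationMap_of_mem_homComponent_singleton {Δ : SimplicialCplx E} {v : E}
    (hv : {v} ∉ Δ)
    {φ : stanleyReisnerIdeal K Δ →ₗ[MvPolynomial E K] (MvPolynomial E K ⧸ stanleyReisnerIdeal K Δ)}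
    (hφ : φ ∈ homComponent _ (negIndicator {v})) :
    φ ∈ LinearMap.range (derivationMap (stanleyReisnerIdeal K Δ)) := by
  obtain ⟨c, hc⟩ := exists_apply_prod_X_eq_of_mem_homComponent hv hφ
  refine ⟨(C c : MvPolynomial E K) • pderiv v, (sub_eq_zero.1 ?_).symm⟩
  refine stanleyReisnerIdeal_hom_eq_zero hv _ ?_ fun F hF hvF ↦ ?_
  · rw [LinearMap.sub_apply, hc, sub_eq_zero]
    change _ = Ideal.Quotient.mk _ (C c * pderiv v (∏ i ∈ {v}, X i))
    rw [Finset.prod_singleton, pderiv_X_self, mul_one]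
  · rw [LinearMap.sub_apply, apply_prod_X_eq_zero_of_mem_homComponent hφ hF hvF, zero_sub,
      neg_eq_zero]
    change Ideal.Quotient.mk _ (C c * pderiv v (∏ i ∈ F, X i)) = 0
    rw [pderiv_prod_X_eq_zero (by simpa using hvF), mul_zero, map_zero]

/-- The value `1` at `x_b` would differ from a polynomial without constant term by an element of
`I_Δ`, which has none either. -/
theorem divMonomialHom_notMem_range_derivationMap [DecidableEq E] {Δ : SimplicialCplx E}
    {b : Finset E} (hΔ : (Δ : Set (Finset E)).Nonempty)
    (h : ∀ F : Finset E, F \ b ∈ Δ → ¬ b ⊆ F → F ∈ Δ) (hb : b ∉ Δ) (hcard : 1 < b.card) :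
    divMonomialHom K h ∉ LinearMap.range (derivationMap (stanleyReisnerIdeal K Δ)) := by
  rintro ⟨D, hD⟩
  have h1 := LinearMap.congr_fun hD ⟨_, prod_X_mem_stanleyReisnerIdeal hb⟩
  rw [divMonomialHom_prod_X h hb] at h1
  change Ideal.Quotient.mk _ (D (∏ i ∈ b, X i)) = Ideal.Quotient.mk _ 1 at h1
  have h2 := constantCoeff_eq_zero_of_mem_stanleyReisnerIdeal hΔ (Ideal.Quotient.eq.1 h1)
  rw [map_sub, constantCoeff_derivation_prod_X hcard, map_one, zero_sub, neg_eq_zero] at h2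
  exact one_ne_zero h2

/-- With `c` the value of `φ` at `x_b`, the difference kills `x_b` and, by degree, all `x_F` with `b
⊄ F`. -/
theorem exists_eq_smul_divMonomialHom [DecidableEq E] {Δ : SimplicialCplx E} {b : Finset E}
    (h : ∀ F : Finset E, F \ b ∈ Δ → ¬ b ⊆ F → F ∈ Δ) (hb : b ∉ Δ)
    {φ : stanleyReisnerIdeal K Δ →ₗ[MvPolynomial E K] (MvPolynomial E K ⧸ stanleyReisnerIdeal K Δ)}
    (hφ : φ ∈ homComponent _ (negIndicator b)) : ∃ c : K, φ = c • divMonomialHom K h := by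
  obtain ⟨c, hc⟩ := exists_apply_prod_X_eq_of_mem_homComponent hb hφ
  refine ⟨c, sub_eq_zero.1 (stanleyReisnerIdeal_hom_eq_zero hb _ ?_ fun F hF hbF ↦
    apply_prod_X_eq_zero_of_mem_homComponent (Submodule.sub_mem _ hφ
      (Submodule.smul_mem _ c (divMonomialHom_mem_homComponent h))) hF hbF)⟩
  rw [LinearMap.sub_apply, LinearMap.smul_apply, hc, divMonomialHom_prod_X h hb, sub_eq_zero,
    ← map_one (Ideal.Quotient.mk _), ← Ideal.Quotient.mkₐ_eq_mk K, ← map_smul,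
    smul_eq_C_mul, mul_one]

theorem rank_submodule_eq_one {V : Type*} [AddCommGroup V] [Module K V] (s : Submodule K V)
    (h : ∃ v ∈ s, v ≠ 0 ∧ s ≤ Submodule.span K {v}) : Module.rank K s = 1 :=
  (rank_submodule_eq_one_iff s).2 h

end StanleyReisner

theorem mainTheorem6 (K : Type*) [Field K] (n : ℕ) (Δ : SimplicialCplx (Fin n))
    (hΔ : (Δ : Set (Finset (Fin n))).Nonempty) (b : Finset (Fin n)) (hb : b ∉ Δ) :
    ((1 < b.card ∧
        SimplicialCplx.Isomorphic Δ
          (SimplicialCplx.join (SimplicialCplx.deletion Δ b) (SimplicialCplx.boundary b))) →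
      Module.rank K (T1Component (stanleyReisnerIdeal K Δ) (negIndicator b)) = 1) ∧
    (¬ (1 < b.card ∧
        SimplicialCplx.Isomorphic Δ
          (SimplicialCplx.join (SimplicialCplx.deletion Δ b) (SimplicialCplx.boundary b))) →
      Module.rank K (T1Component (stanleyReisnerIdeal K Δ) (negIndicator b)) = 0) := by
  constructor
  · rintro ⟨hcard, hiso⟩
    have h := fun F ↦ SimplicialCplx.mem_of_isomorphic_join (F := F) hb hiso
    refine rank_submodule_eq_one _ ⟨_, ⟨divMonomialHom K h,
      divMonomialHom_mem_homComponent h, rfl⟩, fun h0 ↦ ?_, ?_⟩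
    · exact divMonomialHom_notMem_range_derivationMap hΔ h hb hcard
        ((Submodule.Quotient.mk_eq_zero _).1 h0)
    · rintro _ ⟨φ, hφ, rfl⟩
      obtain ⟨c, rfl⟩ := exists_eq_smul_divMonomialHom h hb hφ
      rw [map_smul]
      exact Submodule.smul_mem _ c (Submodule.mem_span_singleton_self _)
  · intro hnot
    suffices hbot : T1Component (stanleyReisnerIdeal K Δ) (negIndicator b) = ⊥ by
      rw [hbot, rank_bot]
    rw [eq_bot_iff]
    rintro _ ⟨φ, hφ, rfl⟩
    refine (Submodule.Quotient.mk_eq_zero _).2 ?_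
    by_cases hcard : 1 < b.card
    -- Here `Δ` is not the join, so `φ` itself vanishes.
    · have h0 : φ ⟨_, prod_X_mem_stanleyReisnerIdeal hb⟩ = 0 := by
        by_contra hne
        exact hnot ⟨hcard, SimplicialCplx.isomorphic_join hb
          fun F ↦ mem_of_apply_prod_X_ne_zero hb hφ hne⟩
      rw [stanleyReisnerIdeal_hom_eq_zero hb φ h0 fun F hF hbF ↦
        apply_prod_X_eq_zero_of_mem_homComponent hφ hF hbF]
      exact Submodule.zero_mem _
    -- The empty set is a face, so `b` must be a singleton.
    · have hne : b ≠ ∅ := by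
        rintro rfl
        obtain ⟨G, hG⟩ := hΔ
        exact hb (Δ.lower (Finset.empty_subset G) hG)
      obtain ⟨v, rfl⟩ := Finset.card_eq_one.1
        (le_antisymm (not_lt.1 hcard) (Finset.card_pos.2 (Finset.nonempty_iff_ne_empty.2 hne)))
      exact mem_range_derivationMap_of_mem_homComponent_singleton hb hφ
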